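/- Let $\mathbb F$ be an algebraically closed field (for instance the algebraic closure of a subfield of $\mathbb C$), let $b\ge 2$ be an integer, and let $M$ be the Mahler operator $y(x)\mapsto y(x^b)$. Let $L=\ell_rM^r+\dots+\ell_1M+\ell_0$ with $\ell_0,\dots,\ell_r\in\mathbb F[x]$, $\ell_0\ell_r\ne 0$ and $\gcd(\ell_0,\dots,\ell_r)=1$, and let $d=\max_k\deg\ell_k$. Set $B_{\mathrm{num}}=2d$, $B_{\mathrm{den}}=2(1-2^{-r})d$ if $b=2$, and $B_{\mathrm{num}}=4d/b^{r-1}$, $B_{\mathrm{den}}=3d/b^{r-1}$ if $b\ge 3$; let $B_\infty=\max(B_{\mathrm{num}},B_{\mathrm{den}})$. Let $z_1,\dots,z_N$ be a basis of the $\mathbb F$-vector space of solutions $y\in\mathbb F[[x]]$ of $Ly=0$, and assume that every Puiseux series solution $y\in\bigcup_{q\ge1}\mathbb F((x^{1/q}))$ of $Ly=0$ lies in $\mathbb F[[x]]$. Put $f=(z_1,\dots,z_N,Mz_1,\dots,Mz_N)$. For $\sigma\in\mathbb N$ let $\mathscr S^{[\sigma]}$ be the $\mathbb F[x]$-module of all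 $w\in\mathbb F[x]^{2N}$ with $\sum_i w_if_i=O(x^\sigma)$, and let $\mathscr S^{[\infty]}$ be the module of all $w$ with $\sum_i w_if_i=0$. For $\sigma\in\mathbb N\cup\{\infty\}$ let $\mathscr T^{[\sigma]}$ be the $\mathbb F$-vector space of those $w\in\mathscr S^{[\sigma]}$ all of whose entries have degree at most $B_\infty$, and let $\rho^{[\sigma]}$ be the rank of the $\mathbb F[x]$-module generated by $\mathscr T^{[\sigma]}$. Let $\sigma\in\mathbb N$ be such that $1\le\rho^{[\sigma]}\le 2N-2$ and $\mathscr T^{[\sigma]}=\mathscr T^{[\infty]}$. Let $(w_1,\dots,w_{2N})$ be a minimal basis of $\mathscr S^{[\sigma]}$, that is, an $\mathbb F[x]$-basis such that for each $i$ the tuple $w_i=(p_1,\dots,p_{2N})$ satisfies $\deg p_j\le\deg p_i$ for $j\le i$ and $\deg p_{j}<\deg p_i$ for $j>i$. Let $W$ be the matrix whose rows are those $w_i$ whose entries all have degree at most $B_\infty$ (there are $\rho^{[\sigma]}$ of them), and let $W_a$ be the matrix with entries in $\mathbb F[a_1,\dots,a_N][x]$ obtained by appending to $W$ the two rows $(a_1,\dots,a_N,0,\dots,0)$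 and $(0,\dots,0,a_1,\dots,a_N)$. Let $\Sigma\subseteq\mathbb F[a_1,\dots,a_N]$ be the set of all coefficients, with respect to the powers of $x$, of the maximal minors (those of order $\rho^{[\sigma]}+2$) of $W_a$. Then the radical of the ideal of $\mathbb F[a_1,\dots,a_N]$ generated by $\Sigma$ is the intersection of a finite set of prime ideals, each of which is generated by homogeneous linear polynomials in $a_1,\dots,a_N$ with coefficients in $\mathbb F$. -/

import Mathlib

open Polynomial

namespace Mahler

noncomputable section

/-! ### Mahler operators acting on power series and on Puiseux series

An operator `L = ℓ_r M ^ r + ⋯ + ℓ_1 M + ℓ_0` of radix `b` over `K[x]` is given by its coefficients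
`ℓ : Fin (r + 1) → K[X]`. -/

/-- The action `y ↦ ∑ k, ℓ_k(x) · M ^ k y` on a commutative ring `A` in which polynomials are
interpreted by `ι` and the Mahler operator by the endomorphism `M`. -/
def opAction {K : Type*} [Field K] {A : Type*} [CommRing A] (ι : K[X] →+* A) (M : A →+* A)
    {r : ℕ} (ℓ : Fin (r + 1) → K[X]) (y : A) : A :=
  ∑ k : Fin (r + 1), ι (ℓ k) * (⇑M)^[(k : ℕ)] y

/-- The Mahler operator `y(x) ↦ y(x ^ b)` on formal power series. -/
def mahlerPS (K : Type*) [Field K] (b : ℕ) (hb : 2 ≤ b) : PowerSeries K →+* PowerSeries K :=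
  (PowerSeries.expand b (by omega) : PowerSeries K →ₐ[K] PowerSeries K).toRingHom

/-- The Mahler operator `y(x) ↦ y(x ^ b)` on Hahn series with rational exponents: the term
`c x ^ e` is mapped to `c x ^ (b e)`. -/
def mahlerHahn (K : Type*) [Field K] (b : ℕ) (hb : 2 ≤ b) : HahnSeries ℚ K →+* HahnSeries ℚ K :=
  HahnSeries.embDomainRingHom (AddMonoidHom.mulLeft (b : ℚ))
    (by
      intro x y h
      have hb' : (b : ℚ) ≠ 0 := by positivity
      simpa [hb'] using h)
    (by
      intro x y
      have hb' : (0 : ℚ) < b := by positivity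
      simp [hb'])

/-- The action of `L` on formal power series. -/
def opPS {K : Type*} [Field K] (b : ℕ) (hb : 2 ≤ b) {r : ℕ} (ℓ : Fin (r + 1) → K[X])
    (y : PowerSeries K) : PowerSeries K :=
  opAction Polynomial.coeToPowerSeries.ringHom (mahlerPS K b hb) ℓ y

/-- The action of `L` on Hahn series with rational exponents. -/
def opHahn {K : Type*} [Field K] (b : ℕ) (hb : 2 ≤ b) {r : ℕ} (ℓ : Fin (r + 1) → K[X])
    (y : HahnSeries ℚ K) : HahnSeries ℚ K :=
  opAction ((HahnSeries.ofPowerSeries ℚ K).comp Polynomial.coeToPowerSeries.ringHom)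
    (mahlerHahn K b hb) ℓ y

/-- The space of formal power series solutions `y ∈ K⟦x⟧` of `L y = 0`. -/
def seriesSolutions {K : Type*} [Field K] (b : ℕ) (hb : 2 ≤ b) {r : ℕ} (ℓ : Fin (r + 1) → K[X]) :
    Submodule K (PowerSeries K) where
  carrier := {y | opPS b hb ℓ y = 0}
  zero_mem' := by
    simp [opPS, opAction, iterate_map_zero]
  add_mem' := by
    intro u v hu hv
    simp only [Set.mem_ofPred_eq, opPS, opAction] at hu hv ⊢
    simp [iterate_map_add, mul_add, Finset.sum_add_distrib] at hu hv ⊢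
    simp [hu, hv]
  smul_mem' := by
    intro c y hy
    have h : ∀ n : ℕ, (⇑(mahlerPS K b hb))^[n] (c • y) = c • (⇑(mahlerPS K b hb))^[n] y := by
      intro n
      induction n with
      | zero => rfl
      | succ n ih =>
        rw [Function.iterate_succ_apply', Function.iterate_succ_apply', ih]
        exact map_smul (PowerSeries.expand b (by omega) : PowerSeries K →ₐ[K] PowerSeries K) c _
    simp only [Set.mem_ofPred_eq, opPS, opAction] at hy ⊢
    simp only [h, mul_smul_comm, ← Finset.smul_sum, hy, smul_zero]

/-- Puiseux series, that is, elements of `⋃_{q ≥ 1} K((x ^ (1/q)))`: Hahn series with rational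
exponents having a common denominator. (The support of a Hahn series is well-ordered, hence the
exponents are then also bounded from below.) -/
def IsPuiseux {K : Type*} [Field K] (y : HahnSeries ℚ K) : Prop :=
  ∃ q : ℕ, 1 ≤ q ∧ ∀ e ∈ y.support, ∃ n : ℤ, e = (n : ℚ) / (q : ℚ)

/-- `y` is a Puiseux series solution of `L y = 0`. -/
def IsPuiseuxSolution {K : Type*} [Field K] (b : ℕ) (hb : 2 ≤ b) {r : ℕ}
    (ℓ : Fin (r + 1) → K[X]) (y : HahnSeries ℚ K) : Prop :=
  IsPuiseux y ∧ opHahn b hb ℓ y = 0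

/-! ### The degree bounds -/

/-- The maximal degree `d` of the coefficients of `L`. -/
def opDegree {K : Type*} [Field K] {r : ℕ} (ℓ : Fin (r + 1) → K[X]) : ℕ :=
  Finset.univ.sup fun k => (ℓ k).natDegree

/-- The bound `B_num`, namely `2 d` if `b = 2` and `4 d / b ^ (r - 1)` if `b ≥ 3`. -/
def Bnum (b r d : ℕ) : ℚ :=
  if b = 2 then 2 * (d : ℚ) else 4 * (d : ℚ) / (b : ℚ) ^ ((r : ℤ) - 1)

/-- The bound `B_den`, namely `2 (1 - 1 / 2 ^ r) d` if `b = 2` and `3 d / b ^ (r - 1)` if `b ≥ 3`. -/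
def Bden (b r d : ℕ) : ℚ :=
  if b = 2 then 2 * (1 - 1 / (2 : ℚ) ^ r) * (d : ℚ) else 3 * (d : ℚ) / (b : ℚ) ^ ((r : ℤ) - 1)

/-- `B_∞ = max (B_num, B_den)`, for the operator with coefficients `ℓ`. -/
def Binf {K : Type*} [Field K] (b : ℕ) {r : ℕ} (ℓ : Fin (r + 1) → K[X]) : ℚ :=
  max (Bnum b r (opDegree ℓ)) (Bden b r (opDegree ℓ))

/-! ### Approximate syzygies and minimal bases -/

/-- The module `𝒮^[σ]` of approximate syzygies to order `σ` of a tuple `f` of power series: the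
`w ∈ K[x]^m` with `∑ i, w_i f_i = O(x ^ σ)`. For `σ = ⊤` it is the module of exact syzygies. -/
def approxSyz {K : Type*} [Field K] {m : ℕ} (f : Fin m → PowerSeries K) (σ : ℕ∞) :
    Submodule K[X] (Fin m → K[X]) where
  carrier := {w | (σ : ℕ∞) ≤ (∑ i, (w i : PowerSeries K) * f i).order}
  zero_mem' := by simp
  add_mem' := by
    intro v w hv hw
    have h : (∑ i, (((v + w) i : K[X]) : PowerSeries K) * f i)
        = (∑ i, (v i : PowerSeries K) * f i) + ∑ i, (w i : PowerSeries K) * f i := by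
      simp [add_mul, Finset.sum_add_distrib]
    simp only [Set.mem_ofPred_eq] at hv hw ⊢
    rw [h]
    exact le_trans (le_min hv hw) (PowerSeries.min_order_le_order_add _ _)
  smul_mem' := by
    intro p w hw
    have h : (∑ i, (((p • w) i : K[X]) : PowerSeries K) * f i)
        = (p : PowerSeries K) * ∑ i, (w i : PowerSeries K) * f i := by
      simp [Finset.mul_sum, mul_assoc]
    simp only [Set.mem_ofPred_eq] at hw ⊢
    rw [h, PowerSeries.order_mul]
    exact le_trans hw le_add_self

/-- The tuple `v` of polynomials has degree at most `B`. -/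
def DegLE {K : Type*} [Field K] {m : ℕ} (B : ℚ) (v : Fin m → K[X]) : Prop :=
  ∀ i, ((v i).natDegree : ℚ) ≤ B

/-- The vectorial truncation `𝒯^[σ] = 𝒮^[σ] ∩ K[x]_{≤ B}^m`, a `K`-vector space. -/
def truncSyz {K : Type*} [Field K] {m : ℕ} (f : Fin m → PowerSeries K) (B : ℚ) (hB : 0 ≤ B)
    (σ : ℕ∞) : Submodule K (Fin m → K[X]) where
  carrier := {w | w ∈ approxSyz f σ ∧ DegLE B w}
  zero_mem' := ⟨zero_mem _, fun i => by simpa using hB⟩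
  add_mem' := by
    rintro v w ⟨hv, hv'⟩ ⟨hw, hw'⟩
    refine ⟨add_mem hv hw, fun i => ?_⟩
    have h : (((v + w) i).natDegree : ℚ) ≤ ((max (v i).natDegree (w i).natDegree : ℕ) : ℚ) := by
      exact_mod_cast Polynomial.natDegree_add_le (v i) (w i)
    refine h.trans ?_
    rw [Nat.cast_max]
    exact max_le (hv' i) (hw' i)
  smul_mem' := by
    rintro c w ⟨hw, hw'⟩
    refine ⟨?_, fun i => ?_⟩
    · have h := (approxSyz f σ).smul_mem (Polynomial.C c) hw
      have e : (Polynomial.C c) • w = c • w := by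
        ext1 i
        simp [Polynomial.smul_eq_C_mul]
      rwa [e] at h
    · have h : (((c • w) i).natDegree : ℚ) ≤ ((w i).natDegree : ℚ) := by
        exact_mod_cast Polynomial.natDegree_smul_le c (w i)
      exact h.trans (hw' i)

theorem Binf_nonneg {K : Type*} [Field K] (b : ℕ) {r : ℕ} (ℓ : Fin (r + 1) → K[X]) :
    0 ≤ Binf b ℓ := by
  refine le_max_of_le_left ?_
  unfold Bnum
  split_ifs <;> positivity

/-- The rank of the `K[x]`-module spanned by a set of `m`-tuples of polynomials. -/
def spanRank {K : Type*} [Field K] {m : ℕ} (T : Submodule K (Fin m → K[X])) : ℕ :=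
  Module.finrank K[X] (Submodule.span K[X] (T : Set (Fin m → K[X])))

/-- A basis `w_1, …, w_m` of a submodule of `K[x]^m` is minimal if, for each `i`, the tuple
`w_i = (p_1, …, p_m)` satisfies `deg p_j ≤ deg p_i > deg p_{j'}` whenever `j ≤ i < j'`. -/
def IsMinimalBasis {K : Type*} [Field K] {m : ℕ} {S : Submodule K[X] (Fin m → K[X])}
    (w : Module.Basis (Fin m) K[X] S) : Prop :=
  ∀ i : Fin m,
    (∀ j, j ≤ i → ((w i : Fin m → K[X]) j).degree ≤ ((w i : Fin m → K[X]) i).degree) ∧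
    (∀ j, i < j → ((w i : Fin m → K[X]) j).degree < ((w i : Fin m → K[X]) i).degree)

/-! ### The generating matrix, the augmented generating matrix and its minors -/

open Classical in
/-- The indices of those rows of a family of tuples that have degree at most `B`. -/
def lowRows {K : Type*} [Field K] {m n : ℕ} (B : ℚ) (w : Fin n → Fin m → K[X]) : Finset (Fin n) :=
  Finset.univ.filter fun i => DegLE B (w i)

/-- The generating matrix `W`: the rows of degree at most `B`, in their order. -/
def genMatrix {K : Type*} [Field K] {m n : ℕ} (B : ℚ) (w : Fin n → Fin m → K[X]) :
    Matrix (Fin (lowRows B w).card) (Fin m) K[X] :=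
  Matrix.of fun k => w ((lowRows B w).orderEmbOfFin rfl k)

/-- For a matrix `W` over `K[x]` with `2 N` columns, the augmented matrix `W_a`, obtained by adding
at the bottom of `W` the rows `(a, 0)` and `(0, a)`, where `a = (a_1, …, a_N)` are indeterminates.
The entries are in `K[a_1, …, a_N][x]`. -/
def augMatrix {K : Type*} [Field K] {N ρ : ℕ} (W : Matrix (Fin ρ) (Fin (N + N)) K[X]) :
    Matrix (Fin (ρ + 2)) (Fin (N + N)) (MvPolynomial (Fin N) K)[X] :=
  Matrix.of (Fin.append
    (fun i j => (W i j).map (MvPolynomial.C : K →+* MvPolynomial (Fin N) K))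
    ![Fin.append (fun i => Polynomial.C (MvPolynomial.X i)) (fun _ => 0),
      Fin.append (fun _ => 0) (fun i => Polynomial.C (MvPolynomial.X i))])

/-- The system `Σ`: the coefficients with respect to `x` of the minors of order `ρ + 2` of the
augmented matrix `W_a` (its maximal minors, as soon as `ρ + 2 ≤ 2 N`). -/
def minorSystem {K : Type*} [Field K] {N ρ : ℕ} (W : Matrix (Fin ρ) (Fin (N + N)) K[X]) :
    Set (MvPolynomial (Fin N) K) :=
  {g | ∃ (c : Fin (ρ + 2) ↪o Fin (N + N)) (m : ℕ),
    g = (((augMatrix W).submatrix id c).det).coeff m}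

/-- The tuple `(z_1, …, z_N, M z_1, …, M z_N)`. -/
def seriesTuple {K : Type*} [Field K] (b : ℕ) (hb : 2 ≤ b) {N : ℕ} (z : Fin N → PowerSeries K) :
    Fin (N + N) → PowerSeries K :=
  Fin.append z (fun i => mahlerPS K b hb (z i))

end

end Mahler

/-! The common zeros of `Σ` form a finite union of linear subspaces of `K ^ N`. The Nullstellensatz
then makes the radical the intersection of their vanishing ideals, which are prime and generated by
linear forms (`vanishingIdeal_submodule`).

Put `y = ∑ a_i z_i`. A point `a` is a common zero iff the rows of `W_a` are dependent over `K[x]`,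
and this holds iff `y` is hypergeometric, i.e. `q · M y = p · y` with `p, q ≠ 0`, where `y = 0` is
allowed. The rows of `W` are exact syzygies because `T^[σ] = T^[∞]`, so a dependence yields `u₀ y +
u₁ M y = 0`. Conversely, the reduced fraction `p / q = M y / y` solves a Riccati equation that
bounds its degrees by `B_∞` (`natDegree_le_Binf`). Hence `(-p a, q a)` lies in `T^[∞] = T^[σ]`, and
minimality of the basis places it in the span of the rows of `W`.

Finally, pairwise non-similar nonzero hypergeometric series are independent over `K[x]`. A
finite-dimensional space thus meets finitely many similarity classes, and each class together with
`0` is a subspace (`exists_iUnion_submodule_eq_hypergeometric`). -/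

namespace Mahler

noncomputable section

/-! ### Vanishing ideals of linear subspaces and the Nullstellensatz -/

section LinearSubspaces

variable {K : Type*} [Field K] {ι : Type*} [Fintype ι]

/-- The substitution in polynomials given by a linear endomorphism of `K ^ ι`. -/
def linSubst [DecidableEq ι] (π : (ι → K) →ₗ[K] (ι → K)) :
    MvPolynomial ι K →ₐ[K] MvPolynomial ι K :=
  MvPolynomial.aeval fun i => ∑ j, π (Pi.single j 1) i • MvPolynomial.X j

theorem aeval_linSubst [DecidableEq ι] (π : (ι → K) →ₗ[K] (ι → K)) (a : ι → K)
    (p : MvPolynomial ι K) :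
    MvPolynomial.aeval a (linSubst π p) = MvPolynomial.aeval (π a) p := by
  have h : (MvPolynomial.aeval a).comp (linSubst π) = MvPolynomial.aeval (R := K) (π a) := by
    apply MvPolynomial.algHom_ext
    intro i
    have h2 : π a = ∑ j, a j • π (Pi.single j 1) := by
      conv_lhs => rw [pi_eq_sum_univ' a]
      simp [map_sum, map_smul, Pi.single]
    simp [linSubst, h2, mul_comm]
  exact DFunLike.congr_fun h p

theorem exists_linear_retraction {V : Type*} [AddCommGroup V] [Module K V] (U : Submodule K V) :
    ∃ π : V →ₗ[K] V, (∀ x, π x ∈ U) ∧ ∀ x ∈ U, π x = x := by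
  obtain ⟨g, hg⟩ := LinearMap.exists_leftInverse_of_injective U.subtype U.ker_subtype
  refine ⟨U.subtype ∘ₗ g, fun x => (g x).2, fun x hx => ?_⟩
  have := DFunLike.congr_fun hg ⟨x, hx⟩
  simp only [LinearMap.comp_apply, Submodule.subtype_apply, LinearMap.id_apply] at this ⊢
  rw [this]

/-- For a linear retraction `π` onto `U`, a polynomial vanishes on `U` iff its pullback along `π` is
zero, `K` being infinite. The ideal is therefore the kernel of an endomorphism of a domain. Modulo
the linear forms `X_i - π^* X_i`, every polynomial equals its pullback, so linear forms vanishing on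
`U` generate. -/
theorem vanishingIdeal_submodule [Infinite K] (U : Submodule K (ι → K)) :
    (MvPolynomial.vanishingIdeal K (U : Set (ι → K))).IsPrime ∧
      ∃ G : Set (MvPolynomial ι K), (∀ g ∈ G, g.IsHomogeneous 1) ∧
        MvPolynomial.vanishingIdeal K (U : Set (ι → K)) = Ideal.span G := by
  classical
  obtain ⟨π, hπ, hπ'⟩ := exists_linear_retraction U
  have hker : MvPolynomial.vanishingIdeal K (U : Set (ι → K)) =
      RingHom.ker (linSubst π : MvPolynomial ι K →ₐ[K] MvPolynomial ι K) := by
    ext p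
    rw [MvPolynomial.mem_vanishingIdeal_iff, RingHom.mem_ker]
    constructor
    · intro h
      apply MvPolynomial.funext
      intro a
      have := aeval_linSubst π a p
      rw [h _ (hπ a)] at this
      simpa [MvPolynomial.aeval_eq_eval] using this
    · intro h a ha
      have := aeval_linSubst π a p
      rw [h, map_zero, hπ' a ha] at this
      exact this.symm
  refine ⟨hker ▸ RingHom.ker_isPrime _, {g | g.IsHomogeneous 1 ∧ ∀ a ∈ U,
    MvPolynomial.aeval a g = 0}, fun g hg => hg.1, le_antisymm ?_ ?_⟩
  · intro p hp
    set G : Set (MvPolynomial ι K) := {g | g.IsHomogeneous 1 ∧ ∀ a ∈ U, MvPolynomial.aeval a g = 0}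
    have hX : ∀ i, MvPolynomial.X i - linSubst π (MvPolynomial.X i) ∈ Ideal.span G := by
      intro i
      apply Ideal.subset_span
      refine ⟨?_, fun a ha => ?_⟩
      · refine (MvPolynomial.isHomogeneous_X K i).sub ?_
        simp only [linSubst, MvPolynomial.aeval_X]
        refine MvPolynomial.IsHomogeneous.sum _ _ _ fun j _ => ?_
        rw [MvPolynomial.smul_eq_C_mul]
        simpa using (MvPolynomial.isHomogeneous_C ι (π (Pi.single j 1) i)).mul
          (MvPolynomial.isHomogeneous_X K j)
      · rw [map_sub, aeval_linSubst, hπ' a ha, sub_self]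
    have hmk : (Ideal.Quotient.mkₐ K (Ideal.span G)).comp (linSubst π) =
        Ideal.Quotient.mkₐ K (Ideal.span G) := by
      apply MvPolynomial.algHom_ext
      intro i
      exact (Ideal.Quotient.eq.2 (hX i)).symm
    have h := DFunLike.congr_fun hmk p
    rw [hker, RingHom.mem_ker] at hp
    rw [AlgHom.comp_apply, show linSubst π p = 0 from hp, map_zero] at h
    exact Ideal.Quotient.eq_zero_iff_mem.1 h.symm
  · rw [Ideal.span_le]
    intro g hg
    exact hg.2

theorem exists_linear_primes_of_zeroLocus_eq_iUnion [IsAlgClosed K] (I : Ideal (MvPolynomial ι K))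
    {κ : Type*} [Finite κ] (U : κ → Submodule K (ι → K))
    (h : MvPolynomial.zeroLocus K I = ⋃ k, (U k : Set (ι → K))) :
    ∃ P : Finset (Ideal (MvPolynomial ι K)), I.radical = P.inf id ∧
      ∀ p ∈ P, p.IsPrime ∧
        ∃ G : Set (MvPolynomial ι K), (∀ g ∈ G, g.IsHomogeneous 1) ∧ p = Ideal.span G := by
  classical
  have : Infinite K := IsAlgClosed.instInfinite
  cases nonempty_fintype κ
  refine ⟨Finset.univ.image fun k => MvPolynomial.vanishingIdeal K (U k : Set (ι → K)), ?_, ?_⟩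
  · rw [← MvPolynomial.vanishingIdeal_zeroLocus_eq_radical (K := K), h]
    ext p
    simp only [Finset.inf_image, Submodule.mem_finsetInf, MvPolynomial.mem_vanishingIdeal_iff,
      Set.mem_iUnion, Function.comp, id, Finset.mem_univ, true_imp_iff]
    exact ⟨fun h i x hx => h x ⟨i, hx⟩, fun h x ⟨i, hx⟩ => h i x hx⟩
  · intro p hp
    obtain ⟨k, -, rfl⟩ := Finset.mem_image.1 hp
    exact vanishingIdeal_submodule (U k)

end LinearSubspaces

/-! ### Row independence and maximal minors -/

section Minors

theorem exists_minor_ne_zero_of_field {F : Type*} [Field F] {m n : ℕ} (A : Matrix (Fin m) (Fin n) F)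
    (h : LinearIndependent F A.row) : ∃ c : Fin m ↪o Fin n, (A.submatrix id c).det ≠ 0 := by
  obtain ⟨κ, a, ha, hs, hli⟩ := exists_linearIndependent' F A.col
  have : Finite κ := Finite.of_injective a ha
  cases nonempty_fintype κ
  have hc : Fintype.card κ = m := by
    have h1 := h.rank_matrix
    rw [A.rank_eq_finrank_span_cols, ← hs, finrank_span_eq_card hli] at h1
    simpa using h1
  set s : Finset (Fin n) := Finset.univ.map ⟨a, ha⟩ with hsdef
  have hsc : s.card = m := by simp [hsdef, hc]
  refine ⟨s.orderEmbOfFin hsc, ?_⟩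
  have hex : ∀ k, ∃ i, a i = s.orderEmbOfFin hsc k := by
    intro k
    have := s.orderEmbOfFin_mem hsc k
    obtain ⟨i, -, hi⟩ := Finset.mem_map.1 this
    exact ⟨i, hi⟩
  choose e he using hex
  have hinj : Function.Injective e := by
    intro i j hij
    apply (s.orderEmbOfFin hsc).injective
    rw [← he, ← he, hij]
  have hli2 : LinearIndependent F (A.submatrix id (s.orderEmbOfFin hsc)).col := by
    have := hli.comp e hinj
    have h3 : (A.submatrix id (s.orderEmbOfFin hsc)).col = (A.col ∘ a) ∘ e := by
      ext k i
      change A i (s.orderEmbOfFin hsc k) = A i (a (e k))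
      rw [he]
    rw [h3]
    exact this
  rw [Matrix.linearIndependent_cols_iff_isUnit, Matrix.isUnit_iff_isUnit_det] at hli2
  exact hli2.ne_zero

/-- Over the fraction field, row rank equals column rank, and a basis of the column space chosen
among the columns gives the minor. Conversely, a relation between the rows is a left kernel vector
of every maximal square submatrix. -/
theorem linearIndependent_row_iff_exists_minor_ne_zero {R : Type*} [CommRing R] [IsDomain R]
    {m n : ℕ} (A : Matrix (Fin m) (Fin n) R) :
    LinearIndependent R A.row ↔ ∃ c : Fin m ↪o Fin n, (A.submatrix id c).det ≠ 0 := by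
  constructor
  · intro h
    let φ : (Fin n → R) →ₗ[R] (Fin n → FractionRing R) :=
      (Algebra.linearMap R (FractionRing R)).compLeft (Fin n)
    have hφ : LinearMap.ker φ = ⊥ := by
      rw [LinearMap.ker_eq_bot]
      intro x y hxy
      ext i
      exact IsFractionRing.injective R (FractionRing R) (congrFun hxy i)
    have h1 := (LinearIndependent.iff_fractionRing R (FractionRing R)).1 (h.map' φ hφ)
    obtain ⟨c, hc⟩ := exists_minor_ne_zero_of_field (A.map (algebraMap R (FractionRing R))) h1
    refine ⟨c, fun h0 => hc ?_⟩
    rw [Matrix.submatrix_map, ← RingHom.mapMatrix_apply, ← RingHom.map_det, h0, map_zero]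
  · rintro ⟨c, hc⟩
    by_contra hli
    obtain ⟨g, hg, i, hi⟩ := Fintype.not_linearIndependent_iff.1 hli
    apply hc
    rw [← Matrix.exists_vecMul_eq_zero_iff]
    refine ⟨g, fun h0 => hi (congrFun h0 i), ?_⟩
    ext j
    have := congrFun hg (c j)
    simpa [Matrix.vecMul, dotProduct, Matrix.row, Finset.sum_apply] using this

end Minors

/-! ### Hypergeometric series and similarity classes -/

section Hypergeometric

variable {K : Type*} [Field K] {b : ℕ} {hb : 2 ≤ b}

theorem mahlerPS_coe (p : K[X]) :
    mahlerPS K b hb (p : PowerSeries K) = (Polynomial.expand K b p : K[X]) := by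
  ext n
  change PowerSeries.coeff n (PowerSeries.expand b _ (p : PowerSeries K)) = _
  rw [PowerSeries.coeff_expand, Polynomial.coeff_coe, Polynomial.coeff_coe,
    Polynomial.coeff_expand (by omega)]

theorem mahlerPS_smul (c : K) (y : PowerSeries K) :
    mahlerPS K b hb (c • y) = c • mahlerPS K b hb y :=
  map_smul (PowerSeries.expand b (by omega) : PowerSeries K →ₐ[K] PowerSeries K) c y

theorem order_mahlerPS (y : PowerSeries K) : (mahlerPS K b hb y).order = b • y.order :=
  PowerSeries.order_expand b (by omega) y

theorem mahlerPS_ne_zero {y : PowerSeries K} (hy : y ≠ 0) : mahlerPS K b hb y ≠ 0 := by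
  intro h
  apply hy
  ext n
  have := PowerSeries.coeff_expand_mul b (by omega) y n
  rw [← this]
  change PowerSeries.coeff (b * n) (mahlerPS K b hb y) = _
  rw [h]
  simp

theorem coe_ne_zero {p : K[X]} (hp : p ≠ 0) : (p : PowerSeries K) ≠ 0 := by
  simpa using hp

/-- Two power series with the same quotient `M y / y` are proportional. -/
theorem exists_eq_smul_of_mahlerPS_mul_eq {s t : PowerSeries K} (ht : t ≠ 0)
    (h : mahlerPS K b hb s * t = mahlerPS K b hb t * s) : ∃ c : K, s = c • t := by
  have hord : ∀ u : PowerSeries K, u ≠ 0 → ∃ n : ℕ, u.order = n := fun u hu => by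
    obtain ⟨n, hn⟩ := ENat.ne_top_iff_exists.1 (fun h => hu (PowerSeries.order_eq_top.1 h))
    exact ⟨n, hn.symm⟩
  obtain ⟨n, hn⟩ := hord t ht
  have hcn : PowerSeries.coeff n t ≠ 0 := (PowerSeries.order_eq_nat.1 hn).1
  -- This constant cancels the coefficient of `s` at `n = ord t`. The difference satisfies the same
  -- equation; if it is nonzero of order `k`, comparing orders gives `b k + n = b n + k`, so `k =
  -- n`, a contradiction.
  refine ⟨PowerSeries.coeff n s / PowerSeries.coeff n t, ?_⟩
  set c := PowerSeries.coeff n s / PowerSeries.coeff n t with hc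
  by_contra hne
  have hu : s - c • t ≠ 0 := sub_ne_zero.2 hne
  obtain ⟨k, hk⟩ := hord _ hu
  have h2 : mahlerPS K b hb (s - c • t) * t = mahlerPS K b hb t * (s - c • t) := by
    rw [map_sub, mahlerPS_smul, sub_mul, h, mul_sub]
    simp
  have h3 := congrArg PowerSeries.order h2
  rw [PowerSeries.order_mul, PowerSeries.order_mul, order_mahlerPS, order_mahlerPS, hn, hk] at h3
  have h4 : b * k + n = b * n + k := by
    simp only [nsmul_eq_mul] at h3
    exact_mod_cast h3
  have h5 : k = n := by
    obtain ⟨b', rfl⟩ : ∃ b', b = b' + 2 := ⟨b - 2, by omega⟩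
    have : (b' + 1) * k = (b' + 1) * n := by linarith
    exact Nat.eq_of_mul_eq_mul_left (by omega) this
  apply (PowerSeries.order_eq_nat.1 hk).1
  rw [h5, map_sub, PowerSeries.coeff_smul, hc]
  simp only [smul_eq_mul]
  field_simp
  simp

variable (b hb) in
/-- `M y` is a rational multiple of `y` (this includes `y = 0`). -/
def IsHypergeometric (y : PowerSeries K) : Prop :=
  ∃ p q : K[X], p ≠ 0 ∧ q ≠ 0 ∧ (q : PowerSeries K) * mahlerPS K b hb y = (p : PowerSeries K) * y

/-- `y'` is a nonzero rational multiple of `y`. -/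
def Similar (y y' : PowerSeries K) : Prop :=
  ∃ p q : K[X], p ≠ 0 ∧ q ≠ 0 ∧ (q : PowerSeries K) * y' = (p : PowerSeries K) * y

theorem Similar.refl (y : PowerSeries K) : Similar y y := ⟨1, 1, one_ne_zero, one_ne_zero, rfl⟩

theorem Similar.symm {y y' : PowerSeries K} (h : Similar y y') : Similar y' y := by
  obtain ⟨p, q, hp, hq, h⟩ := h
  exact ⟨q, p, hq, hp, h.symm⟩

theorem Similar.trans {y y' y'' : PowerSeries K} (h : Similar y y') (h' : Similar y' y'') :
    Similar y y'' := by
  obtain ⟨p, q, hp, hq, h⟩ := h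
  obtain ⟨p', q', hp', hq', h'⟩ := h'
  refine ⟨p' * p, q * q', mul_ne_zero hp' hp, mul_ne_zero hq hq', ?_⟩
  push_cast
  linear_combination (q : PowerSeries K) * h' + (p' : PowerSeries K) * h

theorem IsHypergeometric.of_mul_eq {y s : PowerSeries K} (hy : IsHypergeometric b hb y)
    {p q : K[X]} (hq : q ≠ 0) (h : (q : PowerSeries K) * s = (p : PowerSeries K) * y) :
    IsHypergeometric b hb s := by
  by_cases hp : p = 0
  · have hs : s = 0 := by
      rw [hp, Polynomial.coe_zero, zero_mul] at h
      exact (mul_eq_zero.1 h).resolve_left (coe_ne_zero hq)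
    exact ⟨1, 1, one_ne_zero, one_ne_zero, by simp [hs]⟩
  obtain ⟨p', q', hp', hq', h'⟩ := hy
  have hb0 : 0 < b := by omega
  have hM := congrArg (mahlerPS K b hb) h
  rw [map_mul, map_mul, mahlerPS_coe, mahlerPS_coe] at hM
  refine ⟨expand K b p * p' * q, p * q' * expand K b q, ?_, ?_, ?_⟩
  · exact mul_ne_zero (mul_ne_zero ((expand_ne_zero hb0).2 hp) hp') hq
  · exact mul_ne_zero (mul_ne_zero hp hq') ((expand_ne_zero hb0).2 hq)
  · push_cast
    linear_combination (p : PowerSeries K) * q' * hM + (p : PowerSeries K) * (expand K b p) * h'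
      - (expand K b p : PowerSeries K) * p' * h

/-- Pairwise non-similar hypergeometric series are linearly independent over `K[x]`. -/
theorem eq_zero_of_sum_mul_eq_zero {ι : Type*} (y : ι → PowerSeries K) (hy : ∀ i, y i ≠ 0)
    (hyp : ∀ i, IsHypergeometric b hb (y i)) (hsim : ∀ i j, Similar (y i) (y j) → i = j)
    (S : Finset ι) : ∀ c : ι → K[X], ∑ i ∈ S, (c i : PowerSeries K) * y i = 0 →
      ∀ i ∈ S, c i = 0 := by
  classical
  choose p q hp hq hpq using hyp
  have hb0 : 0 < b := by omega
  induction S using Finset.induction_on with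
  | empty => simp
  | insert j S hj ih =>
    intro c hc
    rw [Finset.sum_insert hj] at hc
    -- Otherwise, eliminating `y j` between the relation and its image under `M` gives a relation
    -- over `S`, trivial by induction. Then `c i * y i` and `c j * y j` have the same quotient `M u
    -- / u`, so they are proportional, against non-similarity.
    have key : c j = 0 ∨ ∀ i ∈ S, c i = 0 := by
      by_contra! hcon
      obtain ⟨hcj, i, hiS, hci⟩ := hcon
      -- A common denominator: `M (y k) / y k = P k / D` for all `k`.
      let D : K[X] := ∏ k ∈ insert j S, q k
      have hD : D ≠ 0 := Finset.prod_ne_zero_iff.2 fun k _ => hq k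
      let P : ι → K[X] := fun k => p k * ∏ l ∈ (insert j S).erase k, q l
      have hDP : ∀ k ∈ insert j S,
          (D : PowerSeries K) * mahlerPS K b hb (y k) = (P k : PowerSeries K) * y k := by
        intro k hk
        have : D = q k * ∏ l ∈ (insert j S).erase k, q l :=
          (Finset.mul_prod_erase _ _ hk).symm
        rw [this]
        simp only [P, Polynomial.coe_mul]
        linear_combination ((∏ l ∈ (insert j S).erase k, q l : K[X]) : PowerSeries K) * hpq k
      have hM := congrArg (mahlerPS K b hb) hc
      rw [map_add, map_sum, map_zero, map_mul, mahlerPS_coe] at hM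
      have hM2 : (expand K b (c j) : PowerSeries K) * P j * y j +
          ∑ k ∈ S, (expand K b (c k) : PowerSeries K) * P k * y k = 0 := by
        have := congrArg (fun u => (D : PowerSeries K) * u) hM
        simp only [mul_add, Finset.mul_sum, mul_zero] at this
        rw [← this]
        congr 1
        · linear_combination -(expand K b (c j) : PowerSeries K) *
            hDP j (Finset.mem_insert_self _ _)
        · refine Finset.sum_congr rfl fun k hk => ?_
          rw [map_mul, mahlerPS_coe]
          linear_combination -(expand K b (c k) : PowerSeries K) *
            hDP k (Finset.mem_insert_of_mem hk)
      have hrel := ih (fun k => expand K b (c j) * P j * c k - c j * (expand K b (c k) * P k)) (by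
        have h1 : ∑ k ∈ S, ((expand K b (c j) * P j * c k - c j * (expand K b (c k) * P k) :
            K[X]) : PowerSeries K) * y k =
            (expand K b (c j) : PowerSeries K) * P j * ∑ k ∈ S, (c k : PowerSeries K) * y k
            - (c j : PowerSeries K) *
              ∑ k ∈ S, (expand K b (c k) : PowerSeries K) * P k * y k := by
          rw [Finset.mul_sum, Finset.mul_sum, ← Finset.sum_sub_distrib]
          refine Finset.sum_congr rfl fun k _ => ?_
          push_cast
          ring
        rw [h1]
        linear_combination (expand K b (c j) : PowerSeries K) * P j * hc
          - (c j : PowerSeries K) * hM2) i hiS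
      have hrel' : (expand K b (c j) : PowerSeries K) * P j * c i =
          c j * (expand K b (c i) * P i) := by
        have := congrArg (fun u : K[X] => (u : PowerSeries K)) (sub_eq_zero.1 hrel)
        push_cast at this
        exact this
      have hi := hDP i (Finset.mem_insert_of_mem hiS)
      have hj' := hDP j (Finset.mem_insert_self _ _)
      have ht : (c j : PowerSeries K) * y j ≠ 0 := mul_ne_zero (coe_ne_zero hcj) (hy j)
      obtain ⟨e, he⟩ := exists_eq_smul_of_mahlerPS_mul_eq (b := b) (hb := hb)
        (s := (c i : PowerSeries K) * y i) ht (by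
          apply mul_left_cancel₀ (coe_ne_zero hD)
          rw [map_mul, map_mul, mahlerPS_coe, mahlerPS_coe]
          linear_combination (expand K b (c i) : PowerSeries K) * c j * y j * hi
            - (expand K b (c j) : PowerSeries K) * c i * y i * hj' - y i * y j * hrel')
      have he0 : e ≠ 0 := by
        rintro rfl
        rw [zero_smul] at he
        exact mul_ne_zero (coe_ne_zero hci) (hy i) he
      have hij : j = i := hsim j i ⟨C e * c j, c i,
        mul_ne_zero (C_ne_zero.2 he0) hcj, hci, by
          rw [he, PowerSeries.smul_eq_C_mul]
          push_cast
          ring⟩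
      exact hj (hij ▸ hiS)
    have hcj : c j = 0 := by
      rcases key with h | h
      · exact h
      · rw [Finset.sum_eq_zero (fun k hk => by simp [h k hk]), add_zero] at hc
        by_contra hne
        exact mul_ne_zero (coe_ne_zero hne) (hy j) hc
    intro i hi
    rcases Finset.mem_insert.1 hi with rfl | hi
    · exact hcj
    · refine ih c ?_ i hi
      simpa [hcj] using hc

/-- The hypergeometric elements of a finite-dimensional space of power series form a finite union
of linear subspaces. -/
theorem exists_iUnion_submodule_eq_hypergeometric.{u} {K : Type u} [Field K] {b : ℕ} {hb : 2 ≤ b}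
    (S : Submodule K (PowerSeries K))
    [Module.Finite K S] :
    ∃ (κ : Type u) (_ : Finite κ) (E : κ → Submodule K S),
      ∀ y : S, IsHypergeometric b hb (y : PowerSeries K) ↔ ∃ k, y ∈ E k := by
  let V := {y : S // y ≠ 0 ∧ IsHypergeometric b hb (y : PowerSeries K)}
  let st : Setoid V :=
    { r := fun y y' => Similar (y.1 : PowerSeries K) (y'.1 : PowerSeries K)
      iseqv := ⟨fun _ => Similar.refl _, fun h => h.symm, fun h h' => h.trans h'⟩ }
  have hfin : Finite (Quotient st) := by
    have hli : LinearIndependent K fun c : Quotient st => (c.out.1 : S) := by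
      rw [linearIndependent_iff']
      intro s g hg i hi
      have h := eq_zero_of_sum_mul_eq_zero (b := b) (hb := hb)
        (fun c : Quotient st => (c.out.1 : PowerSeries K))
        (fun c h => c.out.2.1 (Subtype.ext h)) (fun c => c.out.2.2)
        (fun c c' h => by
          rw [← Quotient.out_eq c, ← Quotient.out_eq c']
          exact Quotient.sound h) s (fun c => C (g c)) (by
          have := congrArg (fun u : S => (u : PowerSeries K)) hg
          simpa [PowerSeries.smul_eq_C_mul] using this) i hi
      simpa using h
    exact hli.finite
  -- Unlike in `Similar`, `p = 0` is allowed, which adds `0` to the class.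
  let E : V → Submodule K S := fun y =>
    { carrier := {s | ∃ p q : K[X], q ≠ 0 ∧
        (q : PowerSeries K) * (s : PowerSeries K) = (p : PowerSeries K) * (y.1 : PowerSeries K)}
      zero_mem' := ⟨0, 1, one_ne_zero, by simp⟩
      add_mem' := by
        rintro s t ⟨p, q, hq, h⟩ ⟨p', q', hq', h'⟩
        refine ⟨p * q' + p' * q, q * q', mul_ne_zero hq hq', ?_⟩
        push_cast
        linear_combination (q' : PowerSeries K) * h + (q : PowerSeries K) * h'
      smul_mem' := by
        rintro c s ⟨p, q, hq, h⟩
        refine ⟨C c * p, q, hq, ?_⟩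
        push_cast
        rw [PowerSeries.smul_eq_C_mul]
        linear_combination (PowerSeries.C c) * h }
  -- The extra index carries the zero subspace, needed when there is no nonzero hypergeometric
  -- element.
  refine ⟨Option (Quotient st), inferInstance, fun o => o.elim ⊥ fun c : Quotient st => E c.out, fun y => ?_⟩
  constructor
  · intro h
    by_cases hy : y = 0
    · exact ⟨none, by simp [hy]⟩
    · refine ⟨some (Quotient.mk st ⟨y, hy, h⟩), ?_⟩
      obtain ⟨p, q, hp, hq, h⟩ := Quotient.mk_out (s := st) ⟨y, hy, h⟩
      exact ⟨p, q, hq, h⟩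
  · rintro ⟨_ | c, hc⟩
    · have hy : y = 0 := hc
      exact ⟨1, 1, one_ne_zero, one_ne_zero, by simp [hy]⟩
    · obtain ⟨p, q, hq, h⟩ := hc
      exact c.out.2.2.of_mul_eq hq h

end Hypergeometric

/-! ### Riccati equation and degree bounds -/

section DegreeBounds

variable {K : Type*} [Field K] {b : ℕ} {hb : 2 ≤ b}

theorem iterate_mahlerPS_coe (p : K[X]) (k : ℕ) :
    (⇑(mahlerPS K b hb))^[k] (p : PowerSeries K) = (expand K (b ^ k) p : K[X]) := by
  induction k with
  | zero => simp
  | succ k ih => rw [Function.iterate_succ_apply', ih, mahlerPS_coe, expand_expand, pow_succ']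

theorem prod_mul_iterate_mahlerPS {y : PowerSeries K} {p q : K[X]}
    (h : (q : PowerSeries K) * mahlerPS K b hb y = (p : PowerSeries K) * y) (k : ℕ) :
    ((∏ j ∈ Finset.range k, expand K (b ^ j) q : K[X]) : PowerSeries K) *
        (⇑(mahlerPS K b hb))^[k] y =
      ((∏ j ∈ Finset.range k, expand K (b ^ j) p : K[X]) : PowerSeries K) * y := by
  induction k with
  | zero => simp
  | succ k ih =>
    have hk := congrArg (⇑(mahlerPS K b hb))^[k] h
    rw [iterate_map_mul, iterate_map_mul, iterate_mahlerPS_coe, iterate_mahlerPS_coe,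
      ← Function.iterate_succ_apply] at hk
    rw [Finset.prod_range_succ, Finset.prod_range_succ]
    rw [Polynomial.coe_mul, Polynomial.coe_mul]
    linear_combination
      ((∏ j ∈ Finset.range k, expand K (b ^ j) q : K[X]) : PowerSeries K) * hk
      + (expand K (b ^ k) p : PowerSeries K) * ih

/-- The Riccati equation satisfied by `p / q = M y / y`. -/
theorem riccati {r : ℕ} {ℓ : Fin (r + 1) → K[X]} {y : PowerSeries K} (hy0 : y ≠ 0)
    (hy : opPS b hb ℓ y = 0) {p q : K[X]}
    (h : (q : PowerSeries K) * mahlerPS K b hb y = (p : PowerSeries K) * y) :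
    ∑ k : Fin (r + 1), ℓ k * ((∏ j ∈ Finset.range k, expand K (b ^ j) p) *
      ∏ j ∈ Finset.Ico (k : ℕ) r, expand K (b ^ j) q) = 0 := by
  have h1 : ((∑ k : Fin (r + 1), ℓ k * ((∏ j ∈ Finset.range k, expand K (b ^ j) p) *
      ∏ j ∈ Finset.Ico (k : ℕ) r, expand K (b ^ j) q) : K[X]) : PowerSeries K) * y =
      ((∏ j ∈ Finset.range r, expand K (b ^ j) q : K[X]) : PowerSeries K) * opPS b hb ℓ y := by
    rw [opPS, opAction, Finset.mul_sum, ← coeToPowerSeries.ringHom_apply, map_sum,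
      Finset.sum_mul]
    refine Finset.sum_congr rfl fun k _ => ?_
    have hk := prod_mul_iterate_mahlerPS h (k : ℕ)
    have hs := Finset.prod_range_mul_prod_Ico (fun j => expand K (b ^ j) q)
      (Nat.le_of_lt_succ k.2)
    rw [← hs]
    simp only [map_mul, coeToPowerSeries.ringHom_apply] at hk ⊢
    rw [Polynomial.coe_mul]
    linear_combination (-(ℓ k : PowerSeries K) *
      ((∏ j ∈ Finset.Ico (k : ℕ) r, expand K (b ^ j) q : K[X]) : PowerSeries K)) * hk
  rw [hy, mul_zero] at h1
  have h2 := (mul_eq_zero.1 h1).resolve_right hy0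
  simpa using h2

theorem natDegree_prod_expand {p : K[X]} (hp : p ≠ 0) (hb0 : 0 < b) (s : Finset ℕ) :
    (∏ j ∈ s, expand K (b ^ j) p).natDegree = p.natDegree * ∑ j ∈ s, b ^ j := by
  rw [natDegree_prod _ _ fun j _ => (expand_ne_zero (pow_pos hb0 j)).2 hp, Finset.mul_sum]
  simp only [natDegree_expand]

theorem natDegree_le_opDegree {r : ℕ} (ℓ : Fin (r + 1) → K[X]) (k : Fin (r + 1)) :
    (ℓ k).natDegree ≤ opDegree ℓ :=
  Finset.le_sup (f := fun k => (ℓ k).natDegree) (Finset.mem_univ k)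

/-- The last term of the Riccati sum must be cancelled by the others. Each of these has `M ^ s q` in
place of `M ^ s p`, and its remaining factors are no larger in degree since `deg q ≤ deg p`. -/
theorem natDegree_mul_pow_le_of_le {s : ℕ} {ℓ : Fin (s + 1 + 1) → K[X]} {p q : K[X]} (hb0 : 0 < b)
    (hlead : ℓ (Fin.last (s + 1)) ≠ 0) (hp : p ≠ 0) (hq : q ≠ 0)
    (h : ∑ k : Fin (s + 1 + 1), ℓ k * ((∏ j ∈ Finset.range k, expand K (b ^ j) p) *
      ∏ j ∈ Finset.Ico (k : ℕ) (s + 1), expand K (b ^ j) q) = 0)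
    (hle : q.natDegree ≤ p.natDegree) :
    p.natDegree * b ^ s ≤ opDegree ℓ + q.natDegree * b ^ s := by
  rw [Fin.sum_univ_castSucc] at h
  have h1 := eq_neg_of_add_eq_zero_right h
  have h2 := congrArg natDegree h1
  have hP : (∏ j ∈ Finset.range (s + 1), expand K (b ^ j) p) ≠ 0 :=
    Finset.prod_ne_zero_iff.2 fun j _ => (expand_ne_zero (pow_pos hb0 j)).2 hp
  simp only [Fin.val_last, Finset.Ico_self, Finset.prod_empty, mul_one] at h2
  rw [natDegree_mul hlead hP, natDegree_prod_expand hp hb0, natDegree_neg,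
    Finset.sum_range_succ] at h2
  have h3 : (∑ i : Fin (s + 1), ℓ i.castSucc * ((∏ j ∈ Finset.range i.castSucc,
      expand K (b ^ j) p) * ∏ j ∈ Finset.Ico (i.castSucc : ℕ) (s + 1),
      expand K (b ^ j) q)).natDegree ≤
      opDegree ℓ + (p.natDegree * (∑ j ∈ Finset.range s, b ^ j) + q.natDegree * b ^ s) := by
    refine natDegree_sum_le_of_forall_le _ _ fun i _ => ?_
    refine natDegree_mul_le.trans (Nat.add_le_add (natDegree_le_opDegree ℓ _) ?_)
    refine natDegree_mul_le.trans ?_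
    rw [natDegree_prod_expand hp hb0, natDegree_prod_expand hq hb0]
    have hi : (i : ℕ) ≤ s := Nat.le_of_lt_succ i.2
    simp only [Fin.val_castSucc]
    rw [Finset.sum_Ico_succ_top hi, ← Finset.sum_range_add_sum_Ico _ hi, mul_add, mul_add]
    have := Nat.mul_le_mul_right (∑ j ∈ Finset.Ico (i : ℕ) s, b ^ j) hle
    omega
  rw [← h2, mul_add] at h3
  omega

/-- `M ^ s q` divides every term of the Riccati sum but the last, hence also the last. Being coprime
to `M ^ s p`, it divides `ℓ_r ∏_{j < s} M ^ j p`. -/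
theorem natDegree_mul_pow_le {s : ℕ} {ℓ : Fin (s + 1 + 1) → K[X]} {p q : K[X]} (hb0 : 0 < b)
    (hlead : ℓ (Fin.last (s + 1)) ≠ 0) (hp : p ≠ 0) (hpq : IsCoprime p q)
    (h : ∑ k : Fin (s + 1 + 1), ℓ k * ((∏ j ∈ Finset.range k, expand K (b ^ j) p) *
      ∏ j ∈ Finset.Ico (k : ℕ) (s + 1), expand K (b ^ j) q) = 0) :
    q.natDegree * b ^ s ≤
      opDegree ℓ + p.natDegree * ∑ j ∈ Finset.range s, b ^ j := by
  rw [Fin.sum_univ_castSucc] at h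
  have hdvd : expand K (b ^ s) q ∣ ∑ i : Fin (s + 1), ℓ i.castSucc *
      ((∏ j ∈ Finset.range i.castSucc, expand K (b ^ j) p) *
      ∏ j ∈ Finset.Ico (i.castSucc : ℕ) (s + 1), expand K (b ^ j) q) := by
    refine Finset.dvd_sum fun i _ => Dvd.dvd.mul_left (Dvd.dvd.mul_left ?_ _) _
    refine Finset.dvd_prod_of_mem (fun j => expand K (b ^ j) q) ?_
    have := i.2
    simp only [Finset.mem_Ico, Fin.val_castSucc]
    omega
  have h1 : expand K (b ^ s) q ∣ ℓ (Fin.last (s + 1)) *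
      ((∏ j ∈ Finset.range s, expand K (b ^ j) p) * expand K (b ^ s) p) := by
    have := (dvd_add_right hdvd).1 (h ▸ dvd_zero _)
    simpa [Finset.prod_range_succ] using this
  rw [← mul_assoc] at h1
  have hcop : IsCoprime (expand K (b ^ s) q) (expand K (b ^ s) p) :=
    hpq.symm.map (expand K (b ^ s)).toRingHom
  have h2 := hcop.dvd_of_dvd_mul_right h1
  have hP : (∏ j ∈ Finset.range s, expand K (b ^ j) p) ≠ 0 :=
    Finset.prod_ne_zero_iff.2 fun j _ => (expand_ne_zero (pow_pos hb0 j)).2 hp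
  have h3 := natDegree_le_of_dvd h2 (mul_ne_zero hlead hP)
  rw [natDegree_mul hlead hP, natDegree_prod_expand hp hb0, natDegree_expand] at h3
  exact h3.trans (Nat.add_le_add_right (natDegree_le_opDegree ℓ _) _)

/-- The degree bound for the reduced fraction `p / q = M y / y`, when `L y = 0`. -/
theorem natDegree_le_Binf {r : ℕ} {ℓ : Fin (r + 1) → K[X]} (hlead : ℓ (Fin.last r) ≠ 0)
    {y : PowerSeries K} (hy0 : y ≠ 0) (hy : opPS b hb ℓ y = 0) {p q : K[X]} (hp : p ≠ 0)
    (hq : q ≠ 0) (hpq : IsCoprime p q)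
    (h : (q : PowerSeries K) * mahlerPS K b hb y = (p : PowerSeries K) * y) :
    (p.natDegree : ℚ) ≤ Binf b ℓ ∧ (q.natDegree : ℚ) ≤ Binf b ℓ := by
  have hb0 : 0 < b := by omega
  have hric := riccati hy0 hy h
  rcases r with _ | s
  -- For `r = 0` the Riccati equation says `ℓ 0 = 0`.
  · simp only [Nat.reduceAdd, Finset.univ_unique, Fin.default_eq_zero, Fin.isValue,
      Finset.sum_singleton] at hric
    simp at hric
    exact absurd hric hlead
  have h1 := natDegree_mul_pow_le hb0 hlead hp hpq hric
  have h2 := natDegree_mul_pow_le_of_le hb0 hlead hp hq hric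
  have hgeom : (b - 1) * (∑ j ∈ Finset.range s, b ^ j) + 1 = b ^ s := by
    clear * - hb0
    induction s with
    | zero => simp
    | succ s ih =>
      obtain ⟨c, rfl⟩ : ∃ c, b = c + 1 := ⟨b - 1, by omega⟩
      rw [Finset.sum_range_succ, mul_add, pow_succ, Nat.add_sub_cancel] at *
      linarith
  generalize (∑ j ∈ Finset.range s, b ^ j) = e at *
  have hB : 0 < b ^ s := pow_pos hb0 s
  generalize hd : opDegree ℓ = d at *
  generalize p.natDegree = dp at *
  generalize q.natDegree = dq at *
  -- With `B = b ^ s` and `e = 1 + ⋯ + b ^ (s - 1)`, the two bounds give `max(dp, dq) · (B - e) ≤ 2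
  -- d`. Here `B - e = 1` if `b = 2`, and `B - e ≥ B / 2` if `b ≥ 3`.
  suffices h : (dp : ℚ) ≤ Bnum b (s + 1) d ∧ (dq : ℚ) ≤ Bnum b (s + 1) d by
    rw [Binf, hd]
    exact ⟨h.1.trans (le_max_left _ _), h.2.trans (le_max_left _ _)⟩
  unfold Bnum
  split_ifs with hb2
  · subst hb2
    norm_num at hgeom
    generalize 2 ^ s = B at *
    suffices dp ≤ 2 * d ∧ dq ≤ 2 * d by exact_mod_cast this
    rw [← hgeom] at h1 h2
    rcases le_or_gt dq dp with hle | hlt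
    · have := h2 hle
      constructor <;> nlinarith
    · have := Nat.mul_le_mul_right e hlt.le
      constructor <;> nlinarith
  · have he : 2 * e ≤ b ^ s := by
      have : 2 * e ≤ (b - 1) * e := Nat.mul_le_mul_right e (by omega)
      omega
    have hpow : (b : ℚ) ^ (((s + 1 : ℕ) : ℤ) - 1) = ((b ^ s : ℕ) : ℚ) := by
      push_cast
      rw [add_sub_cancel_right, zpow_natCast]
    rw [hpow]
    generalize b ^ s = B at *
    have hBq : (0 : ℚ) < B := by exact_mod_cast hB
    rw [le_div_iff₀ hBq, le_div_iff₀ hBq]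
    suffices dp * B ≤ 4 * d ∧ dq * B ≤ 4 * d by exact_mod_cast this
    have h5 := Nat.mul_le_mul_left dp he
    rcases le_or_gt dq dp with hle | hlt
    · have := h2 hle
      have := Nat.mul_le_mul_right B hle
      constructor <;> linarith
    · have := Nat.mul_le_mul_right B hlt.le
      constructor <;> linarith

end DegreeBounds

/-! ### Predictable degrees for minimal bases -/

section MinimalBasis

variable {K : Type*} [Field K] {m : ℕ} {S : Submodule K[X] (Fin m → K[X])}
  {w : Module.Basis (Fin m) K[X] S}

/-- The predictable degree property of minimal bases. -/
theorem IsMinimalBasis.degLE_of_repr_ne_zero (hw : IsMinimalBasis w) {B : ℚ} (t : S)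
    (ht : DegLE B (t : Fin m → K[X])) (i : Fin m) (hi : w.repr t i ≠ 0) :
    DegLE B (w i : Fin m → K[X]) := by
  classical
  have hdiag : ∀ k, (w k : Fin m → K[X]) k ≠ 0 := by
    intro k hk
    apply w.ne_zero k
    ext1
    funext j
    have h : ((w k : Fin m → K[X]) j).degree ≤ ((w k : Fin m → K[X]) k).degree := by
      rcases le_or_gt j k with h | h
      · exact (hw k).1 j h
      · exact ((hw k).2 j h).le
    rw [hk, degree_zero, le_bot_iff, degree_eq_bot] at h
    exact h
  have hle : ∀ k j, ((w k : Fin m → K[X]) j).natDegree ≤ ((w k : Fin m → K[X]) k).natDegree := by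
    intro k j
    apply natDegree_le_natDegree
    rcases le_or_gt j k with h | h
    · exact (hw k).1 j h
    · exact ((hw k).2 j h).le
  set c := w.repr t with hc
  let D : Fin m → ℕ := fun k => (c k).natDegree + ((w k : Fin m → K[X]) k).natDegree
  let I : Finset (Fin m) := Finset.univ.filter fun k => c k ≠ 0
  obtain ⟨i₀, hi₀, hmax⟩ := I.exists_max_image D ⟨i, by simp [I, hi]⟩
  -- `J` is the last index where `D` is maximal. In column `J`, any other maximal row `k` has `k <
  -- J`, hence an entry of degree below its pivot. The coefficient of degree `D i₀` thus comes from
  -- row `J` alone and survives.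
  obtain ⟨J, hJ, hJmax⟩ := (I.filter fun k => D k = D i₀).exists_max_image id
    ⟨i₀, by simp [hi₀]⟩
  rw [Finset.mem_filter] at hJ
  have hcJ : c J ≠ 0 := (Finset.mem_filter.1 hJ.1).2
  have htJ : (t : Fin m → K[X]) J = ∑ k, c k * (w k : Fin m → K[X]) J := by
    have := congrArg (fun u : S => (u : Fin m → K[X]) J) (w.sum_repr t)
    simp only [Submodule.coe_sum, Submodule.coe_smul, Finset.sum_apply, Pi.smul_apply,
      smul_eq_mul] at this
    exact this.symm
  have hcoeff : ((t : Fin m → K[X]) J).coeff (D i₀) =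
      (c J * (w J : Fin m → K[X]) J).coeff (D i₀) := by
    rw [htJ, finsetSum_coeff]
    refine Finset.sum_eq_single J (fun k _ hkJ => ?_) (by simp)
    by_cases hck : c k = 0
    · simp [hck]
    have hkI : k ∈ I := by simp [I, hck]
    rcases (hmax k hkI).lt_or_eq with hlt | heq
    · apply coeff_eq_zero_of_natDegree_lt
      calc _ ≤ (c k).natDegree + ((w k : Fin m → K[X]) J).natDegree := natDegree_mul_le
        _ ≤ D k := Nat.add_le_add_left (hle k J) _
        _ < _ := hlt
    · have hkJ' : k < J := lt_of_le_of_ne (hJmax k (by simp [hkI, heq])) hkJ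
      apply coeff_eq_zero_of_degree_lt
      rw [degree_mul, ← heq, degree_eq_natDegree hck]
      simp only [D]
      rw [Nat.cast_add]
      refine WithBot.add_lt_add_left (by simp) ?_
      rw [← degree_eq_natDegree (hdiag k)]
      exact (hw k).2 J hkJ'
  have hne : ((t : Fin m → K[X]) J).coeff (D i₀) ≠ 0 := by
    rw [hcoeff, ← hJ.2]
    simp only [D]
    rw [coeff_mul_degree_add_degree]
    exact mul_ne_zero (leadingCoeff_ne_zero.2 hcJ) (leadingCoeff_ne_zero.2 (hdiag J))
  intro j
  refine le_trans ?_ (ht J)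
  have h1 : ((w i : Fin m → K[X]) j).natDegree ≤ ((t : Fin m → K[X]) J).natDegree :=
    calc _ ≤ ((w i : Fin m → K[X]) i).natDegree := hle i j
      _ ≤ D i := Nat.le_add_left _ _
      _ ≤ D i₀ := hmax i (by simp [I, hi])
      _ ≤ _ := le_natDegree_of_ne_zero hne
  exact_mod_cast h1

theorem linearIndependent_genMatrix (w : Module.Basis (Fin m) K[X] S) (B : ℚ) :
    LinearIndependent K[X] (genMatrix B fun i => (w i : Fin m → K[X])).row := by
  have h := (w.linearIndependent.map' S.subtype S.ker_subtype).comp _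
    ((lowRows B fun i => (w i : Fin m → K[X])).orderEmbOfFin rfl).injective
  exact h

theorem IsMinimalBasis.mem_span_genMatrix (hw : IsMinimalBasis w) {B : ℚ} {t : Fin m → K[X]}
    (htS : t ∈ S) (ht : DegLE B t) :
    t ∈ Submodule.span K[X] (Set.range (genMatrix B fun i => (w i : Fin m → K[X])).row) := by
  have hsum := congrArg (fun u : S => (u : Fin m → K[X])) (w.sum_repr ⟨t, htS⟩)
  simp only [Submodule.coe_sum, Submodule.coe_smul] at hsum
  rw [← hsum]
  refine Submodule.sum_mem _ fun i _ => ?_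
  by_cases hi : w.repr ⟨t, htS⟩ i = 0
  · simp [hi]
  · refine Submodule.smul_mem _ _ (Submodule.subset_span ?_)
    have hlow : i ∈ lowRows B fun i => (w i : Fin m → K[X]) := by
      simp only [lowRows, Finset.mem_filter, Finset.mem_univ, true_and]
      exact hw.degLE_of_repr_ne_zero ⟨t, htS⟩ ht i hi
    have : i ∈ Set.range ((lowRows B fun i => (w i : Fin m → K[X])).orderEmbOfFin rfl) := by
      rw [Finset.range_orderEmbOfFin]
      exact hlow
    obtain ⟨k, hk⟩ := this
    exact ⟨k, congrArg (fun i => (w i : Fin m → K[X])) hk⟩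

theorem genMatrix_mem (w : Module.Basis (Fin m) K[X] S) (B : ℚ) (k) :
    (genMatrix B fun i => (w i : Fin m → K[X])) k ∈ S ∧
      DegLE B ((genMatrix B fun i => (w i : Fin m → K[X])) k) := by
  refine ⟨(w _).2, ?_⟩
  have := Finset.orderEmbOfFin_mem (lowRows B fun i => (w i : Fin m → K[X])) rfl k
  simp only [lowRows, Finset.mem_filter, Finset.mem_univ, true_and] at this
  exact this

end MinimalBasis

/-! ### Dependence of the rows of the augmented matrix -/

section Augmented

variable {K : Type*} [Field K] {N ρ : ℕ}

/-- The matrix `W_a` for a specific `a ∈ K ^ N`. -/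
def augMatrixAt (W : Matrix (Fin ρ) (Fin (N + N)) K[X]) (a : Fin N → K) :
    Matrix (Fin (ρ + 2)) (Fin (N + N)) K[X] :=
  Matrix.of (Fin.append W
    ![Fin.append (fun i => C (a i)) (fun _ => 0), Fin.append (fun _ => 0) (fun i => C (a i))])

theorem augMatrixAt_castAdd (W : Matrix (Fin ρ) (Fin (N + N)) K[X]) (a : Fin N → K) (i : Fin ρ) :
    augMatrixAt W a (Fin.castAdd 2 i) = W i :=
  Fin.append_left (α := Fin (N + N) → K[X]) W _ i

theorem augMatrixAt_natAdd (W : Matrix (Fin ρ) (Fin (N + N)) K[X]) (a : Fin N → K) (i : Fin 2) :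
    augMatrixAt W a (Fin.natAdd ρ i) =
      ![Fin.append (fun i => C (a i)) (fun _ => 0), Fin.append (fun _ => 0) (fun i => C (a i))] i :=
  Fin.append_right (α := Fin (N + N) → K[X]) W _ i

theorem map_augMatrix (W : Matrix (Fin ρ) (Fin (N + N)) K[X]) (a : Fin N → K) :
    (augMatrix W).map (mapRingHom (MvPolynomial.aeval a : MvPolynomial (Fin N) K →ₐ[K] K).toRingHom)
      = augMatrixAt W a := by
  have hC : (MvPolynomial.aeval a : MvPolynomial (Fin N) K →ₐ[K] K).toRingHom.comp
      MvPolynomial.C = RingHom.id K := by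
    ext x
    simp
  ext1 i j
  rw [Matrix.map_apply]
  refine Fin.addCases (fun i => ?_) (fun i => ?_) i
  · rw [augMatrixAt_castAdd, augMatrix, Matrix.of_apply, Fin.append_left, coe_mapRingHom,
      Polynomial.map_map, hC, Polynomial.map_id]
  · rw [augMatrixAt_natAdd, augMatrix, Matrix.of_apply, Fin.append_right]
    fin_cases i <;> refine Fin.addCases (fun j => ?_) (fun j => ?_) j <;>
      simp [-Fin.natAdd_eq_addNat]

/-- Specialization at `a` commutes with minors and with taking coefficients in `x`, so the system
vanishes at `a` iff all maximal minors of the specialized matrix do. -/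
theorem mem_zeroLocus_minorSystem_iff (W : Matrix (Fin ρ) (Fin (N + N)) K[X]) (a : Fin N → K) :
    a ∈ MvPolynomial.zeroLocus K (Ideal.span (minorSystem W)) ↔
      ¬ LinearIndependent K[X] (augMatrixAt W a).row := by
  rw [linearIndependent_row_iff_exists_minor_ne_zero, MvPolynomial.zeroLocus_span]
  simp only [Set.mem_ofPred_eq, not_exists, not_not]
  have h : ∀ (c : Fin (ρ + 2) ↪o Fin (N + N)) (n : ℕ),
      MvPolynomial.aeval a ((((augMatrix W).submatrix id c).det).coeff n) =
        (((augMatrixAt W a).submatrix id c).det).coeff n := by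
    intro c n
    rw [← map_augMatrix, Matrix.submatrix_map, ← RingHom.mapMatrix_apply, ← RingHom.map_det,
      coe_mapRingHom, coeff_map]
    rfl
  constructor
  · intro ha c
    ext n
    rw [← h, coeff_zero]
    exact ha _ ⟨c, n, rfl⟩
  · rintro ha _ ⟨c, n, rfl⟩
    rw [h, ha c, coeff_zero]

theorem sum_smul_augMatrixAt (W : Matrix (Fin ρ) (Fin (N + N)) K[X]) (a : Fin N → K)
    (v : Fin (ρ + 2) → K[X]) :
    ∑ k, v k • (augMatrixAt W a).row k = ∑ k, v (Fin.castAdd 2 k) • W k +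
      Fin.append (fun i => v (Fin.natAdd ρ 0) * C (a i)) (fun i => v (Fin.natAdd ρ 1) * C (a i)) := by
  rw [Fin.sum_univ_add]
  congr 1
  · refine Finset.sum_congr rfl fun k _ => ?_
    rw [Matrix.row, augMatrixAt_castAdd]
  · rw [Fin.sum_univ_two, Matrix.row, augMatrixAt_natAdd, augMatrixAt_natAdd]
    ext1 j
    refine Fin.addCases (fun j => ?_) (fun j => ?_) j <;> simp [-Fin.natAdd_eq_addNat]

/-- Exact syzygies pair to zero with the tuple. -/
theorem mem_approxSyz_top {m : ℕ} {f : Fin m → PowerSeries K} {v : Fin m → K[X]} :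
    v ∈ approxSyz f ⊤ ↔ ∑ i, (v i : PowerSeries K) * f i = 0 := by
  change (⊤ : ℕ∞) ≤ PowerSeries.order _ ↔ _
  rw [top_le_iff, PowerSeries.order_eq_top]

variable {b : ℕ} {hb : 2 ≤ b}

theorem sum_append_mul_seriesTuple (z : Fin N → PowerSeries K) (u v : K[X]) (a : Fin N → K) :
    ∑ i, ((Fin.append (fun i => u * C (a i)) (fun i => v * C (a i)) i : K[X]) : PowerSeries K) *
        seriesTuple b hb z i =
      (u : PowerSeries K) * (∑ i, a i • z i) +
        (v : PowerSeries K) * mahlerPS K b hb (∑ i, a i • z i) := by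
  rw [Fin.sum_univ_add, map_sum, Finset.mul_sum, Finset.mul_sum]
  congr 1 <;> refine Finset.sum_congr rfl fun i _ => ?_
  · simp only [seriesTuple, Fin.append_left, PowerSeries.smul_eq_C_mul]
    push_cast
    ring
  · rw [mahlerPS_smul]
    simp only [seriesTuple, Fin.append_right, PowerSeries.smul_eq_C_mul]
    push_cast
    ring

theorem isHypergeometric_of_not_linearIndependent {z : Fin N → PowerSeries K}
    {W : Matrix (Fin ρ) (Fin (N + N)) K[X]} (hW : LinearIndependent K[X] W.row)
    (hsyz : ∀ k, W k ∈ approxSyz (seriesTuple b hb z) ⊤) {a : Fin N → K}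
    (h : ¬ LinearIndependent K[X] (augMatrixAt W a).row) :
    IsHypergeometric b hb (∑ i, a i • z i) := by
  obtain ⟨v, hv, k₀, hk₀⟩ := Fintype.not_linearIndependent_iff.1 h
  rw [sum_smul_augMatrixAt] at hv
  set u₀ := v (Fin.natAdd ρ 0) with hu₀
  set u₁ := v (Fin.natAdd ρ 1) with hu₁
  by_cases hy : ∑ i, a i • z i = 0
  · exact ⟨1, 1, one_ne_zero, one_ne_zero, by simp [hy]⟩
  have hmem : Fin.append (fun i => u₀ * C (a i)) (fun i => u₁ * C (a i)) ∈
      approxSyz (seriesTuple b hb z) ⊤ := by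
    rw [← neg_eq_of_add_eq_zero_right hv]
    exact neg_mem (sum_mem fun k _ => Submodule.smul_mem _ _ (hsyz k))
  rw [mem_approxSyz_top, sum_append_mul_seriesTuple] at hmem
  -- If `u₁ = 0`, then `u₀ y = 0` forces `u₀ = 0`, leaving a nontrivial relation between the rows of
  -- `W`.
  have hzero : u₁ ≠ 0 := by
    intro h1
    have h0 : u₀ = 0 := by
      rw [h1, Polynomial.coe_zero, zero_mul, add_zero] at hmem
      simpa using (mul_eq_zero.1 hmem).resolve_right hy
    have happ : Fin.append (fun i => u₀ * C (a i)) (fun i => u₁ * C (a i)) = 0 := by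
      ext1 j
      refine Fin.addCases (fun j => ?_) (fun j => ?_) j <;> simp [h0, h1, -Fin.natAdd_eq_addNat]
    rw [happ, add_zero] at hv
    have hc := Fintype.linearIndependent_iff.1 hW _ hv
    apply hk₀
    refine Fin.addCases (fun k => hc k) (fun k => ?_) k₀
    fin_cases k
    · exact h0
    · exact h1
  refine ⟨-u₀, u₁, ?_, hzero, ?_⟩
  · intro h0
    rw [neg_eq_zero.1 h0, Polynomial.coe_zero, zero_mul, zero_add] at hmem
    exact mul_ne_zero (coe_ne_zero hzero) (mahlerPS_ne_zero hy) hmem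
  · push_cast
    linear_combination hmem

theorem not_linearIndependent_of_append_mem_span {W : Matrix (Fin ρ) (Fin (N + N)) K[X]}
    {a : Fin N → K} {p q : K[X]} (hq : q ≠ 0)
    (h : Fin.append (fun i => p * C (a i)) (fun i => q * C (a i)) ∈
      Submodule.span K[X] (Set.range W.row)) :
    ¬ LinearIndependent K[X] (augMatrixAt W a).row := by
  obtain ⟨c, hc⟩ := (Submodule.mem_span_range_iff_exists_fun K[X]).1 h
  rw [Fintype.not_linearIndependent_iff]
  refine ⟨Fin.append (fun k => - c k) ![p, q], ?_, Fin.natAdd ρ 1, ?_⟩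
  · rw [sum_smul_augMatrixAt]
    simp only [Fin.append_left, Fin.append_right, neg_smul, Finset.sum_neg_distrib]
    rw [show ∑ k, c k • W k = _ from hc]
    simp
  · rw [Fin.append_right]
    simpa using hq

theorem IsHypergeometric.exists_isCoprime {y : PowerSeries K} (h : IsHypergeometric b hb y) :
    ∃ p q : K[X], p ≠ 0 ∧ q ≠ 0 ∧ IsCoprime p q ∧
      (q : PowerSeries K) * mahlerPS K b hb y = (p : PowerSeries K) * y := by
  classical
  obtain ⟨p, q, hp, hq, h⟩ := h
  obtain ⟨p', hp'⟩ := EuclideanDomain.gcd_dvd_left p q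
  obtain ⟨q', hq'⟩ := EuclideanDomain.gcd_dvd_right p q
  have hg : EuclideanDomain.gcd p q ≠ 0 := fun h0 => hp (by rw [hp', h0, zero_mul])
  have hcop := EuclideanDomain.gcd_eq_gcd_ab p q
  generalize EuclideanDomain.gcd p q = g at *
  refine ⟨p', q', right_ne_zero_of_mul (hp' ▸ hp), right_ne_zero_of_mul (hq' ▸ hq),
    ⟨EuclideanDomain.gcdA p q, EuclideanDomain.gcdB p q, ?_⟩, ?_⟩
  · apply mul_left_cancel₀ hg
    linear_combination -hcop - EuclideanDomain.gcdA p q * hp' - EuclideanDomain.gcdB p q * hq'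
  · apply mul_left_cancel₀ (coe_ne_zero hg)
    rw [hp', hq'] at h
    push_cast at h
    linear_combination h

end Augmented

end

end Mahler

/-! ### The zero locus of the minor system -/

open Mahler in
theorem mainTheorem7 {K : Type*} [Field K] [IsAlgClosed K]
    (b : ℕ) (hb : 2 ≤ b) (r : ℕ) (ℓ : Fin (r + 1) → Polynomial K)
    (hlead : ℓ (Fin.last r) ≠ 0) (hzero : ℓ 0 ≠ 0)
    (hprim : ∀ p : Polynomial K, (∀ k, p ∣ ℓ k) → IsUnit p)
    (N : ℕ) (z : Module.Basis (Fin N) K (Mahler.seriesSolutions b hb ℓ))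
    (hPuiseux : ∀ y : HahnSeries ℚ K, Mahler.IsPuiseuxSolution b hb ℓ y →
      ∃ s : PowerSeries K, y = HahnSeries.ofPowerSeries ℚ K s)
    (f : Fin (N + N) → PowerSeries K)
    (hf : f = Mahler.seriesTuple b hb (fun i => (z i : PowerSeries K)))
    (T : ℕ∞ → Submodule K (Fin (N + N) → Polynomial K))
    (hT : T = Mahler.truncSyz f (Mahler.Binf b ℓ) (Mahler.Binf_nonneg b ℓ))
    (σ : ℕ) (hρ_pos : 1 ≤ Mahler.spanRank (T σ)) (hρ_le : Mahler.spanRank (T σ) + 2 ≤ 2 * N)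
    (hσ : T σ = T ⊤)
    (w : Module.Basis (Fin (N + N)) (Polynomial K) (Mahler.approxSyz f σ))
    (hw : Mahler.IsMinimalBasis w) :
    ∃ P : Finset (Ideal (MvPolynomial (Fin N) K)),
      (Ideal.span (Mahler.minorSystem (Mahler.genMatrix (Mahler.Binf b ℓ)
        (fun i => (w i : Fin (N + N) → Polynomial K))))).radical = P.inf id ∧
      ∀ p ∈ P, p.IsPrime ∧
        ∃ G : Set (MvPolynomial (Fin N) K), (∀ g ∈ G, g.IsHomogeneous 1) ∧ p = Ideal.span G := by
  have : Module.Finite K (seriesSolutions b hb ℓ) := Module.Finite.of_basis z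
  have hTmem : ∀ (τ : ℕ∞) v, v ∈ T τ ↔ v ∈ approxSyz f τ ∧ DegLE (Binf b ℓ) v := by
    subst hT
    exact fun _ _ => Iff.rfl
  obtain ⟨κ, hκ, E, hE⟩ := exists_iUnion_submodule_eq_hypergeometric (hb := hb)
    (seriesSolutions b hb ℓ)
  refine exists_linear_primes_of_zeroLocus_eq_iUnion _
    (fun k => (E k).comap (z.equivFun.symm : (Fin N → K) →ₗ[K] seriesSolutions b hb ℓ)) ?_
  ext a
  have hcoe : ((z.equivFun.symm a : seriesSolutions b hb ℓ) : PowerSeries K) =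
      ∑ i, a i • (z i : PowerSeries K) := by
    rw [Module.Basis.equivFun_symm_apply]
    simp
  rw [mem_zeroLocus_minorSystem_iff, Set.mem_iUnion]
  simp only [SetLike.mem_coe, Submodule.mem_comap, LinearEquiv.coe_coe]
  rw [← hE, hcoe]
  have hW := genMatrix_mem w (Binf b ℓ)
  constructor
  · refine isHypergeometric_of_not_linearIndependent (linearIndependent_genMatrix w _) fun k => ?_
    have h := (hTmem σ _).2 (hW k)
    rw [hσ, hTmem] at h
    exact hf ▸ h.1
  · intro hyp
    by_cases hy : ∑ i, a i • (z i : PowerSeries K) = 0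
    · have ha : a = 0 := by
        rw [← hcoe] at hy
        exact z.equivFun.symm.map_eq_zero_iff.1 (Subtype.ext hy)
      -- Here the two appended rows are zero, so any multipliers with `q ≠ 0` will do.
      refine not_linearIndependent_of_append_mem_span (p := 1) (q := 1) one_ne_zero ?_
      convert Submodule.zero_mem _ using 1
      ext1 j
      refine Fin.addCases (fun j => ?_) (fun j => ?_) j <;> simp [ha, -Fin.natAdd_eq_addNat]
    obtain ⟨p, q, hp, hq, hpq, h⟩ := hyp.exists_isCoprime
    have hsol : opPS b hb ℓ (∑ i, a i • (z i : PowerSeries K)) = 0 := by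
      rw [← hcoe]
      exact (z.equivFun.symm a).2
    obtain ⟨hdp, hdq⟩ := natDegree_le_Binf hlead hy hsol hp hq hpq h
    refine not_linearIndependent_of_append_mem_span (p := -p) (q := q) hq ?_
    -- The equation `q · M y = p · y` read as an exact syzygy of degree at most `B_∞`; `hσ` moves it
    -- to order `σ`, where the minimal basis lives.
    have hmem : Fin.append (fun i => -p * C (a i)) (fun i => q * C (a i)) ∈ T σ := by
      rw [hσ, hTmem]
      constructor
      · rw [mem_approxSyz_top, hf, sum_append_mul_seriesTuple, h]
        push_cast
        ring
      · have hmul : ∀ (u : K[X]) (c : K), (u.natDegree : ℚ) ≤ Binf b ℓ →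
            ((u * C c).natDegree : ℚ) ≤ Binf b ℓ := fun u c hu =>
          le_trans (by exact_mod_cast natDegree_mul_C_le u c) hu
        intro j
        refine Fin.addCases (fun j => ?_) (fun j => ?_) j
        · rw [Fin.append_left]
          exact hmul _ _ (by rwa [natDegree_neg])
        · rw [Fin.append_right]
          exact hmul _ _ hdq
    rw [hTmem] at hmem
    exact hw.mem_span_genMatrix hmem.1 hmem.2
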